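/- All matroids have finite ground sets. A matroid $M$ is a *gammoid* if there are a finite directed graph $D$, a set $B$ of vertices of $D$, and an injection $\varphi$ from $E(M)$ to the vertex set of $D$ such that a set $I\subseteq E(M)$ is independent in $M$ if and only if $\varphi(I)$ is linked into $B$, that is, there are pairwise vertex-disjoint directed paths in $D$ (single vertices being allowed as paths), one starting at each vertex of $\varphi(I)$, all ending in $B$. If $F$ is a flat of a matroid $M$ and $e\notin E(M)$, the *principal extension* of $M$ into $F$ by $e$ is the matroid $M'$ on $E(M)\cup\{e\}$ such that $M'\setminus e=M$ and a subset of $E(M)$ spans $e$ if and only if it spans $F$. A matroid is *$U_{0,0}$-constructed* if it can be obtained from the matroid $U_{0,0}$ with empty ground set by a finite (possibly empty) sequence of the following operations: relabelling elements, deletion, contraction, adding a coloop, and principal extension. **Theorem.** A matroid is a gammoid if and only if it is $U_{0,0}$-constructed. Equivalently, the class of gammoids is the smallest nonempty class of matroids that is closed under isomorphism, minors, adding coloops and principal extensions: it is such a class, and it is contained in every such class. -/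

import Mathlib

universe u

open Set
open scoped Matroid

namespace Digraph

/-- A directed path in `D`: a nonempty sequence of distinct vertices, each of which is joined to the
next one by an arc. A single vertex is a path. -/
structure IsDirectedPath {V : Type u} (D : Digraph V) (p : List V) : Prop where
  ne_nil : p ≠ []
  nodup : p.Nodup
  chain : p.IsChain D.Adj

/-- `X` is linked into `B` in `D`: there are pairwise vertex-disjoint directed paths, one starting at
each vertex of `X`, all of which end in `B`. -/
def LinkedInto {V : Type u} (D : Digraph V) (X B : Set V) : Prop :=
  ∃ P : V → List V,
    (∀ x ∈ X, D.IsDirectedPath (P x) ∧ (P x).head? = some x ∧ ∃ b ∈ B, (P x).getLast? = some b) ∧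
    ∀ x ∈ X, ∀ y ∈ X, x ≠ y → (P x).Disjoint (P y)

end Digraph

namespace Matroid

/-- `M` is a gammoid: for some finite digraph `D` and some set `B` of vertices of `D`, the elements
of `M` can be identified (by the injection `φ`) with vertices of `D` in such a way that a set of
elements of `M` is independent if and only if it is linked into `B`. -/
def IsGammoid {α : Type u} (M : Matroid α) : Prop :=
  ∃ (V : Type u) (_ : Finite V) (D : Digraph V) (B : Set V) (φ : M.E ↪ V),
    ∀ I : Set M.E, M.Indep ((↑) '' I) ↔ D.LinkedInto (φ '' I) B

/-- `M'` is obtained from `M` by adding the new element `e` as a coloop. -/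
structure IsColoopExtension {α : Type u} (M : Matroid α) (e : α) (M' : Matroid α) : Prop where
  notMem : e ∉ M.E
  ground : M'.E = insert e M.E
  delete_eq : M' ＼ {e} = M
  coloop : M'.IsColoop e

/-- `M'` is the principal extension of `M` into the flat `F` by the new element `e`. -/
structure IsPrincipalExtension {α : Type u} (M : Matroid α) (F : Set α) (e : α) (M' : Matroid α) :
    Prop where
  flat : M.IsFlat F
  notMem : e ∉ M.E
  ground : M'.E = insert e M.E
  delete_eq : M' ＼ {e} = M
  spans_iff : ∀ X ⊆ M.E, e ∈ M'.closure X ↔ F ⊆ M'.closure X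

/-- `Constructed N M`: the matroid `M` is `N`-constructed, that is, obtained from `N` by a finite
sequence of relabellings, deletions, contractions, additions of coloops and principal extensions.
A relabelling replaces the ground set by any set in bijection with it, possibly in another type. -/
inductive Constructed {γ : Type u} (N : Matroid γ) : {α : Type u} → Matroid α → Prop
  | base : Constructed N N
  | relabel {α β : Type u} {M : Matroid α} {E : Set β} (e : M.E ≃ E) :
      Constructed N M → Constructed N (M.mapSetEquiv e)
  | delete {α : Type u} {M : Matroid α} (D : Set α) : Constructed N M → Constructed N (M ＼ D)
  | contract {α : Type u} {M : Matroid α} (C : Set α) : Constructed N M → Constructed N (M ／ C)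
  | addColoop {α : Type u} {M M' : Matroid α} {e : α} :
      M.IsColoopExtension e M' → Constructed N M → Constructed N M'
  | principal {α : Type u} {M M' : Matroid α} {F : Set α} {e : α} :
      M.IsPrincipalExtension F e M' → Constructed N M → Constructed N M'

/-- The matroid `U_{0,0}` with empty ground set. -/
def U00 : Matroid PEmpty.{u + 1} := emptyOn PEmpty

/-- A class of matroids, given by its membership predicate. Classes are ordered by inclusion. -/
abbrev MatroidClass : Type (u + 1) := ∀ α : Type u, Matroid α → Prop

/-- `𝓒` is a nonempty class of finite matroids that is closed under isomorphism, minors, adding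
coloops and principal extensions. -/
structure IsClosedClass (𝓒 : MatroidClass.{u}) : Prop where
  finite : ∀ {α : Type u} {M : Matroid α}, 𝓒 α M → M.Finite
  nonempty : ∃ (α : Type u) (M : Matroid α), 𝓒 α M
  iso : ∀ {α β : Type u} {M : Matroid α} {E : Set β} (e : M.E ≃ E), 𝓒 α M → 𝓒 β (M.mapSetEquiv e)
  minor : ∀ {α : Type u} {M N : Matroid α}, N ≤m M → 𝓒 α M → 𝓒 α N
  addColoop : ∀ {α : Type u} {M M' : Matroid α} {e : α},
    M.IsColoopExtension e M' → 𝓒 α M → 𝓒 α M'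
  principal : ∀ {α : Type u} {M M' : Matroid α} {F : Set α} {e : α},
    M.IsPrincipalExtension F e M' → 𝓒 α M → 𝓒 α M'

end Matroid

/-! Linkings are replaced by matchings. Give each vertex `w` outside `B` the set consisting of `w`
and its out-neighbours. Then `X` is linked into `B` exactly when these sets have distinct
representatives outside `X`: a linking and a matching determine each other through successors. Hence
gammoids are the matroids of `IsPresented`, whose independent sets are those avoidable by a system
of distinct representatives of a fixed finite family.

In this form every operation acts on the family: contraction removes points from its sets, a coloop
is a point in no set, and a principal extension into `F` by `e` adds the set `F ∪ {e}`. So gammoids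
form a closed class.

Conversely, start from the free matroid on the points and add one element `w` for each set,
generically on the span of that set. A set of points together with all the `w` is independent
exactly when the family has representatives avoiding those points, so contracting all the `w` and
restricting gives the presented matroid. This needs principal extensions to exist, which is proved
for finite matroids. Every closed class contains the constructed matroids, whence minimality. -/

/-- The family of sets `{x | r w x}`, indexed by `w`, has a system of distinct representatives that
avoids `X`. -/
def HasSDRAvoiding {W R : Type*} (r : W → R → Prop) (X : Set R) : Prop :=
  ∃ g : W → R, g.Injective ∧ ∀ w, r w (g w) ∧ g w ∉ X

lemma HasSDRAvoiding.mono {W R : Type*} {r : W → R → Prop} {X Y : Set R} (hXY : X ⊆ Y)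
    (h : HasSDRAvoiding r Y) : HasSDRAvoiding r X :=
  let ⟨g, hg, hgr⟩ := h
  ⟨g, hg, fun w ↦ ⟨(hgr w).1, fun hw ↦ (hgr w).2 (hXY hw)⟩⟩

lemma hasSDRAvoiding_map_iff {W R R' : Type*} {r : W → R → Prop} {f : R → R'} (hf : f.Injective)
    {X : Set R'} :
    HasSDRAvoiding (fun w u ↦ ∃ v, u = f v ∧ r w v) X ↔ HasSDRAvoiding r (f ⁻¹' X) := by
  constructor
  · rintro ⟨g, hg, hgr⟩
    choose g' hg' hr using fun w ↦ (hgr w).1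
    refine ⟨g', fun w w' hw ↦ hg (by rw [hg', hg', hw]), fun w ↦ ⟨hr w, ?_⟩⟩
    rw [mem_preimage, ← hg']
    exact (hgr w).2
  · rintro ⟨g, hg, hgr⟩
    exact ⟨f ∘ g, hf.comp hg, fun w ↦ ⟨⟨g w, rfl, (hgr w).1⟩, (hgr w).2⟩⟩

/-- The representative of the extra set is chosen first; it then becomes one more point that the
others must avoid. -/
lemma hasSDRAvoiding_option_iff {W R : Type*} {r : Option W → R → Prop} {X : Set R} :
    HasSDRAvoiding r X ↔
      ∃ u, r none u ∧ u ∉ X ∧ HasSDRAvoiding (fun w ↦ r (some w)) (insert u X) := by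
  constructor
  · rintro ⟨g, hg, hgr⟩
    refine ⟨g none, (hgr none).1, (hgr none).2, g ∘ some, hg.comp (Option.some_injective W),
      fun w ↦ ⟨(hgr _).1, ?_⟩⟩
    rintro (h | h)
    exacts [Option.some_ne_none w (hg h), (hgr _).2 h]
  · rintro ⟨u, hu, huX, g, hg, hgr⟩
    refine ⟨fun o ↦ o.elim u g, ?_, ?_⟩
    · rintro (_ | w) (_ | w') h
      · rfl
      · exact absurd (.inl h.symm) (hgr w').2
      · exact absurd (.inl h) (hgr w).2
      · exact congrArg some (hg h)
    · rintro (_ | w)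
      exacts [⟨hu, huX⟩, ⟨(hgr w).1, fun h ↦ (hgr w).2 (.inr h)⟩]

/-! ### Linkings and systems of distinct representatives -/

namespace Digraph

variable {V : Type u} {D : Digraph V} {X B : Set V}

/-- A vertex on a path is sent to its successor, a vertex on no path to itself. A vertex outside `B`
is never the last of its path, and a starting vertex, having no predecessor, is never a value. -/
lemma LinkedInto.hasSDRAvoiding (h : D.LinkedInto X B) :
    HasSDRAvoiding (fun (w : ↥Bᶜ) (u : V) ↦ u = w ∨ D.Adj w u) X := by
  obtain ⟨P, hP, hdisj⟩ := h
  have key : ∀ w : ↥Bᶜ, ∃ u : V, (u = w ∧ ∀ x ∈ X, (w : V) ∉ P x) ∨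
      ∃ x ∈ X, ∃ i, ∃ h : i + 1 < (P x).length, (P x)[i] = w ∧ (P x)[i + 1] = u := by
    rintro ⟨v, hv⟩
    by_cases hvP : ∃ x ∈ X, v ∈ P x
    · obtain ⟨x, hx, hvx⟩ := hvP
      obtain ⟨i, hi, hiv⟩ := List.getElem_of_mem hvx
      obtain ⟨-, -, b, hb, hlast⟩ := hP x hx
      have hlt : i + 1 < (P x).length := by
        by_contra hcon
        obtain rfl : i = (P x).length - 1 := by omega
        rw [List.getLast?_eq_getElem?, List.getElem?_eq_getElem hi, Option.some_inj, hiv] at hlast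
        exact hv (hlast ▸ hb)
      exact ⟨_, .inr ⟨x, hx, i, hlt, hiv, rfl⟩⟩
    · push Not at hvP
      exact ⟨v, .inl ⟨rfl, hvP⟩⟩
  choose g hg using key
  have hsame : ∀ {x y v}, x ∈ X → y ∈ X → v ∈ P x → v ∈ P y → x = y := by
    intro x y v hx hy hvx hvy
    by_contra hne
    exact hdisj x hx y hy hne hvx hvy
  refine ⟨g, fun w w' hww ↦ ?_, fun w ↦ ⟨?_, fun hwX ↦ ?_⟩⟩
  · rcases hg w with ⟨h1, h2⟩ | ⟨x, hx, i, hi, h1, h2⟩ <;>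
      rcases hg w' with ⟨h1', h2'⟩ | ⟨x', hx', i', hi', h1', h2'⟩
    · exact Subtype.ext (by rw [← h1, hww, h1'])
    · refine absurd (List.getElem_mem hi') ?_
      rw [h2', ← hww, h1]
      exact h2 x' hx'
    · refine absurd (List.getElem_mem hi) ?_
      rw [h2, hww, h1']
      exact h2' x hx
    · obtain rfl := hsame hx hx' (List.getElem_mem hi) (by rw [h2, hww, ← h2']; simp)
      have := ((hP x hx).1.nodup.getElem_inj_iff (hi := hi) (hj := hi')).1 (by rw [h2, h2', hww])
      obtain rfl : i = i' := by omega
      exact Subtype.ext (by rw [← h1, h1'])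
  · rcases hg w with ⟨h1, -⟩ | ⟨x, hx, i, hi, h1, h2⟩
    · exact .inl h1
    · refine .inr ?_
      rw [← h1, ← h2]
      exact List.isChain_iff_getElem.1 (hP x hx).1.chain i hi
  · have hhead : (g w) ∈ P (g w) := List.mem_of_mem_head? (hP _ hwX).2.1
    rcases hg w with ⟨h1, h2⟩ | ⟨x, hx, i, hi, h1, h2⟩
    · exact h2 _ hwX (by rwa [h1] at hhead ⊢)
    · obtain rfl := hsame hx hwX (v := g w) (by rw [← h2]; simp) hhead
      have h0 := (hP _ hx).2.1
      rw [List.head?_eq_getElem?, List.getElem?_eq_getElem (by omega), Option.some_inj] at h0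
      have := ((hP _ hx).1.nodup.getElem_inj_iff (hi := by omega) (hj := hi)).1 (h0.trans h2.symm)
      omega

/-- The paths are the orbits of the matching from the points of `X`, stopped on first reaching `B`.
-/
lemma linkedInto_of_hasSDRAvoiding [Finite V]
    (h : HasSDRAvoiding (fun (w : ↥Bᶜ) (u : V) ↦ u = w ∨ D.Adj w u) X) : D.LinkedInto X B := by
  classical
  obtain ⟨g, hinj, hg⟩ := h
  -- The values on `B` are arbitrary, since orbits are only followed until they reach `B`.
  let G : V → V := fun v ↦ if hv : v ∈ B then v else g ⟨v, hv⟩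
  have hG : ∀ {v}, v ∉ B → (G v = v ∨ D.Adj v (G v)) ∧ G v ∉ X := by
    intro v hv
    simpa only [G, dif_neg hv] using hg ⟨v, hv⟩
  have hGinj : ∀ {v v'}, v ∉ B → v' ∉ B → G v = G v' → v = v' := by
    intro v v' hv hv' h
    simp only [G, dif_neg hv, dif_neg hv'] at h
    exact congrArg Subtype.val (hinj h)
  -- Injectivity lets both orbits be traced back in step until one is at its start in `X`; as `G`
  -- takes no value in `X` off `B`, the other must be at its start too.
  have orbit : ∀ {x y}, x ∈ X → y ∈ X → ∀ i j, (∀ k < i, G^[k] x ∉ B) → (∀ k < j, G^[k] y ∉ B) →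
      G^[i] x = G^[j] y → x = y ∧ i = j := by
    intro x y hx hy i
    induction i with
    | zero =>
      rintro (_ | j) - hj h
      · exact ⟨h, rfl⟩
      · rw [Function.iterate_succ_apply'] at h
        exact absurd (h ▸ hx) (hG (hj j (by omega))).2
    | succ i ih =>
      rintro (_ | j) hi hj h
      · rw [Function.iterate_succ_apply'] at h
        exact absurd (h ▸ hy) (hG (hi i (by omega))).2
      · rw [Function.iterate_succ_apply', Function.iterate_succ_apply'] at h
        obtain ⟨rfl, rfl⟩ := ih j (fun k hk ↦ hi k (by omega)) (fun k hk ↦ hj k (by omega))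
          (hGinj (hi i (by omega)) (hj j (by omega)) h)
        exact ⟨rfl, rfl⟩
  have hex : ∀ x ∈ X, ∃ n, G^[n] x ∈ B := by
    intro x hx
    by_contra! hcon
    exact not_injective_infinite_finite (fun n ↦ G^[n] x)
      fun i j h ↦ (orbit hx hx i j (fun k _ ↦ hcon k) (fun k _ ↦ hcon k) h).2
  have hn : ∀ x, ∃ n, x ∈ X → G^[n] x ∈ B ∧ ∀ k < n, G^[k] x ∉ B := by
    intro x
    by_cases hx : x ∈ X
    · exact ⟨Nat.find (hex x hx), fun _ ↦
        ⟨Nat.find_spec (hex x hx), fun k hk ↦ Nat.find_min (hex x hx) hk⟩⟩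
    · exact ⟨0, fun h ↦ absurd h hx⟩
  choose n hn using hn
  refine ⟨fun x ↦ (List.range (n x + 1)).map (fun k ↦ G^[k] x), fun x hx ↦
    ⟨⟨by simp, ?_, ?_⟩, by simp, G^[n x] x, (hn x hx).1, ?_⟩,
    fun x hx y hy hxy ↦ ?_⟩
  · refine List.Nodup.map_on (fun i hi j hj h ↦ ?_) List.nodup_range
    rw [List.mem_range] at hi hj
    exact (orbit hx hx i j (fun k hk ↦ (hn x hx).2 k (by omega))
      (fun k hk ↦ (hn x hx).2 k (by omega)) h).2
  · rw [List.isChain_iff_getElem]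
    intro i hi
    simp only [List.length_map, List.length_range] at hi
    simp only [List.getElem_map, List.getElem_range]
    have hlt : ∀ k < i + 1, G^[k] x ∉ B := fun k hk ↦ (hn x hx).2 k (by omega)
    rw [Function.iterate_succ_apply']
    -- A fixed point would make the orbit repeat, so each step is an arc.
    refine ((hG (hlt i (by omega))).1).resolve_left fun h ↦ ?_
    rw [← Function.iterate_succ_apply' G] at h
    have := (orbit hx hx (i + 1) i hlt (fun k hk ↦ hlt k (by omega)) h).2
    omega
  · simp [List.range_succ]
  · intro v hvx hvy
    simp only [List.mem_map, List.mem_range] at hvx hvy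
    obtain ⟨i, hi, rfl⟩ := hvx
    obtain ⟨j, hj, h⟩ := hvy
    exact hxy (orbit hx hy i j (fun k hk ↦ (hn x hx).2 k (by omega))
      (fun k hk ↦ (hn y hy).2 k (by omega)) h.symm).1

/-- A set `X` is linked into `B` if and only if the vertices outside `B` can be matched injectively
to themselves or their out-neighbours, outside `X`. -/
lemma linkedInto_iff_hasSDRAvoiding [Finite V] : D.LinkedInto X B ↔
    HasSDRAvoiding (fun (w : ↥Bᶜ) (u : V) ↦ u = w ∨ D.Adj w u) X :=
  ⟨LinkedInto.hasSDRAvoiding, linkedInto_of_hasSDRAvoiding⟩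

end Digraph

/-! ### Gammoids as matroids presented by a family of sets -/

namespace Matroid

variable {α β : Type u} {M M' : Matroid α} {e : α} {F I J : Set α}

/-- `M` is presented by a finite family of sets: its elements are identified with points in such a
way that the independent sets are those that some system of distinct representatives avoids. -/
def IsPresented (M : Matroid α) : Prop :=
  ∃ (W R : Type u) (_ : Finite W) (_ : Finite R) (r : W → R → Prop) (φ : α → R),
    InjOn φ M.E ∧ ∀ I ⊆ M.E, M.Indep I ↔ HasSDRAvoiding r (φ '' I)

lemma IsGammoid.isPresented (h : M.IsGammoid) : M.IsPresented := by
  classical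
  obtain ⟨V, _, D, B, φ, h⟩ := h
  -- The extra point `none` lies in no set and is the default image of elements outside the ground
  -- set.
  refine ⟨↥Bᶜ, Option V, inferInstance, inferInstance, fun w u ↦ ∃ v, u = some v ∧
    (v = w ∨ D.Adj w v), fun a ↦ if ha : a ∈ M.E then some (φ ⟨a, ha⟩) else none, ?_, ?_⟩
  · intro a ha b hb hab
    simpa [ha, hb] using hab
  · intro I hI
    rw [hasSDRAvoiding_map_iff (Option.some_injective V), ← D.linkedInto_iff_hasSDRAvoiding]
    convert h (Subtype.val ⁻¹' I) using 2
    · rw [Subtype.image_preimage_coe, inter_eq_self_of_subset_right hI]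
    · ext v
      simp only [mem_preimage, mem_image, Subtype.exists]
      constructor
      · rintro ⟨a, ha, h⟩
        exact ⟨a, hI ha, ha, by simpa [hI ha] using h⟩
      · rintro ⟨a, ha, haI, rfl⟩
        exact ⟨a, haI, by simp [ha]⟩

lemma IsPresented.isGammoid (h : M.IsPresented) : M.IsGammoid := by
  obtain ⟨W, R, _, _, r, φ, hφ, h⟩ := h
  obtain ⟨g₀, hg₀, hr₀⟩ := (h ∅ (empty_subset _)).1 M.empty_indep
  -- Independence of the empty set provides representatives `g₀`. Naming each set by its
  -- representative makes it the closed out-neighbourhood of a vertex, and these vertices are those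
  -- outside `B`.
  refine ⟨R, inferInstance, ⟨fun v u ↦ ∃ w, g₀ w = v ∧ r w u⟩, (range g₀)ᶜ,
    ⟨fun a ↦ φ a, hφ.injective⟩, fun I ↦ ?_⟩
  have himg : (⟨fun a : M.E ↦ φ a, hφ.injective⟩ : M.E ↪ R) '' I = φ '' (Subtype.val '' I) := by
    rw [image_image]; rfl
  rw [h _ (Subtype.coe_image_subset _ _), Digraph.linkedInto_iff_hasSDRAvoiding, himg]
  constructor
  · rintro ⟨g, hg, hgr⟩
    have hmem : ∀ w : ↥((range g₀)ᶜᶜ), ∃ w', g₀ w' = w := fun w ↦ by simpa using w.2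
    choose p hp using hmem
    refine ⟨fun w ↦ g (p w), fun w w' hw ↦ Subtype.ext ?_, fun w ↦
      ⟨.inr ⟨p w, hp w, (hgr _).1⟩, (hgr _).2⟩⟩
    rw [← hp, ← hp, hg hw]
  · rintro ⟨g, hg, hgr⟩
    have hmem : ∀ w, g₀ w ∈ ((range g₀)ᶜᶜ) := fun w ↦ by simp
    refine ⟨fun w ↦ g ⟨g₀ w, hmem w⟩, fun w w' hw ↦ hg₀ (congrArg Subtype.val (hg hw)), fun w ↦
      ⟨?_, (hgr _).2⟩⟩
    rcases (hgr ⟨g₀ w, hmem w⟩).1 with h | ⟨w', hw', hr⟩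
    · have := (hr₀ w).1
      rwa [← show _ = g₀ w from h] at this
    · rwa [hg₀ hw'] at hr

/-! ### Existence of principal extensions -/

/-- Subsets of an independent set form modular pairs: the closures of `I + x` and `I + y` meet in
the closure of `I`, so they cannot both contain `F`. -/
lemma not_subset_closure_insert_or {x y : α} (hI : M.Indep (insert x (insert y I)))
    (hxy : x ≠ y) (hx : x ∉ I) (hF : ¬ F ⊆ M.closure I) :
    ¬ F ⊆ M.closure (insert x I) ∨ ¬ F ⊆ M.closure (insert y I) := by
  by_contra! hcon
  refine hF ((subset_inter hcon.1 hcon.2).trans ?_)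
  rw [← Indep.closure_inter_eq_inter_closure (by rwa [insert_union, union_insert,
    union_self])]
  refine M.closure_subset_closure fun z hz ↦ ?_
  rcases hz.1 with rfl | h
  · exact hz.2.resolve_left hxy
  · exact h

/-- Otherwise `I` spans `J` and `F`. Some `f ∈ F` extends `J` to an independent set larger than `I`
but still inside the closure of `I`, which is absurd. -/
lemma Indep.exists_insert_of_subset_closure (hI : M.Indep I) (hJ : M.Indep J) (hJfin : J.Finite)
    (hIJ : I.encard ≤ J.encard) (hFI : F ⊆ M.closure I) (hFJ : ¬ F ⊆ M.closure J) :
    ∃ x ∈ J, x ∉ I ∧ M.Indep (insert x I) := by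
  by_contra! hcon
  have hJI : J ⊆ M.closure I := by
    intro x hx
    by_contra hxI
    have hxI' : x ∉ I := fun h ↦ hxI (M.mem_closure_of_mem h hI.subset_ground)
    exact hcon x hx hxI' ((hI.notMem_closure_iff_of_notMem hxI' (hJ.subset_ground hx)).1 hxI)
  obtain ⟨f, hf, hfJ⟩ := not_subset.1 hFJ
  have hfE := M.mem_ground_of_mem_closure (hFI hf)
  have hfJ' : f ∉ J := fun h ↦ hfJ (M.mem_closure_of_mem h hJ.subset_ground)
  have hins := (hJ.notMem_closure_iff_of_notMem hfJ' hfE).1 hfJ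
  have hlt : I.encard < (insert f J).encard := by
    rw [encard_insert_of_notMem hfJ']
    exact hIJ.trans_lt (ENat.lt_add_one_iff (by simpa using hJfin) |>.2 le_rfl)
  obtain ⟨x, ⟨hx, hxI⟩, hxind⟩ := hI.exists_insert_of_encard_lt hins hlt
  refine (hI.notMem_closure_iff_of_notMem hxI (hxind.subset_ground (mem_insert _ _))).2 hxind ?_
  rcases hx with rfl | hx
  exacts [hFI hf, hJI hx]

/-- There is room to augment twice, and one of the two new elements alone leaves `F` unspanned. -/
lemma Indep.exists_insert_of_encard_add_one_lt (hI : M.Indep I) (hJ : M.Indep J)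
    (hIJ : I.encard + 1 < J.encard) (hF : ¬ F ⊆ M.closure I) :
    ∃ x ∈ J, x ∉ I ∧ M.Indep (insert x I) ∧ ¬ F ⊆ M.closure (insert x I) := by
  obtain ⟨x, ⟨hxJ, hxI⟩, hx⟩ := hI.exists_insert_of_encard_lt hJ (le_self_add.trans_lt hIJ)
  obtain ⟨y, ⟨hyJ, hyI⟩, hy⟩ := hx.exists_insert_of_encard_lt hJ
    (by rwa [encard_insert_of_notMem hxI])
  rw [mem_insert_iff, not_or] at hyI
  rcases not_subset_closure_insert_or hy hyI.1 hyI.2 hF with h | h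
  · exact ⟨y, hyJ, hyI.2, hy.subset (insert_subset_insert (subset_insert _ _)), h⟩
  · exact ⟨x, hxJ, hxI, hx, h⟩

/-- If the first augmenting element makes `I` span `F`, then a second one exists because `J` does
not span `F`, and that one alone is safe. -/
lemma Indep.exists_insert_of_encard_lt_of_not_subset (hI : M.Indep I) (hJ : M.Indep J)
    (hJfin : J.Finite) (hIJ : I.encard < J.encard) (hFI : ¬ F ⊆ M.closure I)
    (hFJ : ¬ F ⊆ M.closure J) :
    ∃ x ∈ J, x ∉ I ∧ M.Indep (insert x I) ∧ ¬ F ⊆ M.closure (insert x I) := by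
  obtain ⟨x, ⟨hxJ, hxI⟩, hx⟩ := hI.exists_insert_of_encard_lt hJ hIJ
  by_cases hFx : F ⊆ M.closure (insert x I)
  · obtain ⟨y, hyJ, hyI, hy⟩ := hx.exists_insert_of_subset_closure hJ hJfin
      (by rw [encard_insert_of_notMem hxI]; exact Order.add_one_le_of_lt hIJ) hFx hFJ
    rw [mem_insert_iff, not_or] at hyI
    exact ⟨y, hyJ, hyI.2, hy.subset (insert_subset_insert (subset_insert _ _)),
      (not_subset_closure_insert_or hy hyI.1 hyI.2 hFI).resolve_right (not_not.2 hFx)⟩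
  · exact ⟨x, hxJ, hxI, hx, hFx⟩

/-- The independent sets of the principal extension of `M` by `e` into the closure of `F`. -/
def PrincipalIndep (M : Matroid α) (F : Set α) (e : α) (I : Set α) : Prop :=
  M.Indep (I \ {e}) ∧ (e ∈ I → ¬ F ⊆ M.closure (I \ {e}))

/-- The augmentation axiom, by whether `e` lies in `I` and in `J`; each case strips `e` and uses
augmentation in `M`, except that `e` itself is added when only `J` contains it and `I` does not span
`F`. -/
lemma PrincipalIndep.exists_insert [M.Finite] (hI : PrincipalIndep M F e I)
    (hJ : PrincipalIndep M F e J) (hIJ : I.encard < J.encard) :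
    ∃ x ∈ J, x ∉ I ∧ PrincipalIndep M F e (insert x I) := by
  have hIfin := M.ground_finite.subset hI.1.subset_ground
  have hJfin := M.ground_finite.subset hJ.1.subset_ground
  have key : (∃ x ∈ J \ {e}, x ∉ I \ {e} ∧ M.Indep (insert x (I \ {e})) ∧
      (e ∈ I → ¬ F ⊆ M.closure (insert x (I \ {e})))) →
      ∃ x ∈ J, x ∉ I ∧ PrincipalIndep M F e (insert x I) := by
    rintro ⟨x, ⟨hxJ, hxe⟩, hxI, hx⟩
    refine ⟨x, hxJ, fun h ↦ hxI ⟨h, hxe⟩, ?_⟩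
    rw [PrincipalIndep, ← insert_sdiff_singleton_comm hxe]
    exact ⟨hx.1, fun h ↦ hx.2 (h.resolve_left (Ne.symm hxe))⟩
  by_cases heI : e ∈ I <;> by_cases heJ : e ∈ J
  · apply key
    rw [← encard_sdiff_singleton_add_one heI, ← encard_sdiff_singleton_add_one heJ] at hIJ
    obtain ⟨x, h1, h2, h3, h4⟩ := hI.1.exists_insert_of_encard_lt_of_not_subset hJ.1 hJfin
      (lt_of_add_lt_add_right hIJ) (hI.2 heI) (hJ.2 heJ)
    exact ⟨x, h1, h2, h3, fun _ ↦ h4⟩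
  · apply key
    rw [← encard_sdiff_singleton_add_one heI, ← sdiff_singleton_eq_self heJ] at hIJ
    obtain ⟨x, h1, h2, h3, h4⟩ := hI.1.exists_insert_of_encard_add_one_lt hJ.1 hIJ (hI.2 heI)
    exact ⟨x, h1, h2, h3, fun _ ↦ h4⟩
  · rw [← encard_sdiff_singleton_add_one heJ, ← sdiff_singleton_eq_self heI] at hIJ
    by_cases hF : F ⊆ M.closure (I \ {e})
    · apply key
      obtain ⟨x, h1, h2, h3⟩ := hI.1.exists_insert_of_subset_closure hJ.1 hJfin
        (Order.le_of_lt_add_one hIJ) hF (hJ.2 heJ)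
      exact ⟨x, h1, h2, h3, fun h ↦ absurd h heI⟩
    · refine ⟨e, heJ, heI, ?_⟩
      rw [PrincipalIndep, insert_sdiff_of_mem _ (mem_singleton e)]
      exact ⟨hI.1, fun _ ↦ hF⟩
  · apply key
    rw [← sdiff_singleton_eq_self heI, ← sdiff_singleton_eq_self heJ] at hIJ
    obtain ⟨x, ⟨h1, h2⟩, h3⟩ := hI.1.exists_insert_of_encard_lt hJ.1 hIJ
    exact ⟨x, h1, h2, h3, fun h ↦ absurd h heI⟩

/-- Every finite matroid has a principal extension into every flat. -/
theorem exists_isPrincipalExtension [M.Finite] (hF : M.IsFlat F) (he : e ∉ M.E) :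
    ∃ M', M.IsPrincipalExtension F e M' := by
  have hsub : ∀ I, PrincipalIndep M F e I → I ⊆ insert e M.E := fun I hI x hx ↦ by
    by_cases hxe : x = e
    exacts [.inl hxe, .inr (hI.1.subset_ground ⟨hx, hxe⟩)]
  obtain ⟨M', hE, hInd⟩ : ∃ M' : Matroid α, M'.E = insert e M.E ∧
      ∀ I, M'.Indep I ↔ PrincipalIndep M F e I := by
    refine ⟨(IndepMatroid.ofFinite (E := insert e M.E) (M.ground_finite.insert e)
      (PrincipalIndep M F e) ⟨by simp, by simp⟩
      (fun I J hJ hIJ ↦ ⟨hJ.1.subset (sdiff_subset_sdiff_left hIJ), fun heI hFI ↦ hJ.2 (hIJ heI)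
        (hFI.trans (M.closure_subset_closure (sdiff_subset_sdiff_left hIJ)))⟩)
      (fun I J hI hJ hIJ ↦ ?_) hsub).matroid, rfl, fun I ↦ Iff.rfl⟩
    have hfin := (M.ground_finite.insert e)
    refine hI.exists_insert hJ ?_
    rwa [← (hfin.subset (hsub I hI)).cast_ncard_eq, ← (hfin.subset (hsub J hJ)).cast_ncard_eq,
      Nat.cast_lt]
  have hdel : M' ＼ {e} = M := by
    refine ext_indep (by simp [hE, he]) fun I hI ↦ ?_
    have heI : e ∉ I := fun h ↦ (hI h).2 rfl
    rw [deleteElem_indep_iff, hInd, PrincipalIndep, sdiff_singleton_eq_self heI]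
    tauto
  refine ⟨M', hF, he, hE, hdel, fun X hX ↦ ?_⟩
  -- Spanning depends only on a basis of `X`, for which it is read off from the independence of `I +
  -- e`.
  obtain ⟨I, hI⟩ := M'.exists_isBasis X (hX.trans (by simp [hE]))
  have heI : e ∉ I := fun h ↦ he (hX (hI.subset h))
  have hcl : M'.closure I \ {e} = M.closure I := by
    rw [← hdel, delete_closure_eq_of_disjoint _ (by simpa)]
  have hFcl : F ⊆ M'.closure I ↔ F ⊆ M.closure I := by
    rw [← hcl, subset_sdiff, disjoint_singleton_right,
      and_iff_left (fun h ↦ he (hF.subset_ground h))]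
  rw [← hI.closure_eq_closure, hFcl, ← not_iff_not,
    hI.indep.notMem_closure_iff_of_notMem heI (by simp [hE]), hInd, PrincipalIndep,
    insert_sdiff_of_mem _ (mem_singleton e), sdiff_singleton_eq_self heI]
  have := (hInd I).1 hI.indep
  rw [PrincipalIndep, sdiff_singleton_eq_self heI] at this
  simp [this.1]

/-! ### Independence in extensions -/

lemma indep_iff_of_deleteElem_eq (h : M' ＼ {e} = M) (he : e ∉ I) : M'.Indep I ↔ M.Indep I := by
  rw [← h, deleteElem_indep_iff, and_iff_left he]

/-- The new element can be exchanged for some element of `F`. Here `F` only generates the flat, so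
this applies directly to the sets of a presentation. -/
lemma IsPrincipalExtension.indep_insert_iff (h : M.IsPrincipalExtension (M.closure F) e M')
    (hF : F ⊆ M.E) (hI : I ⊆ M.E) :
    M'.Indep (insert e I) ↔ ∃ f ∈ F, f ∉ I ∧ M.Indep (insert f I) := by
  have heI : e ∉ I := fun he ↦ h.notMem (hI he)
  have hne : ∀ f ∈ F, e ∉ insert f I := fun f hf ↦ by
    rintro (rfl | he)
    exacts [h.notMem (hF hf), heI he]
  have hcl : M.closure F ⊆ M'.closure I ↔ F ⊆ M'.closure I := by
    refine ⟨fun hss ↦ (M.subset_closure F hF).trans hss, fun hss ↦ ?_⟩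
    have hdel : M.closure F ⊆ M'.closure F := by
      rw [← h.delete_eq, delete_closure_eq_of_disjoint]
      · exact sdiff_subset
      · exact disjoint_singleton_right.2 fun he ↦ h.notMem (hF he)
    exact hdel.trans (closure_subset_closure_of_subset_closure hss)
  constructor
  · intro hins
    have hI' := hins.subset (subset_insert e I)
    have hnot := (hI'.notMem_closure_iff_of_notMem heI (hins.subset_ground (mem_insert _ _))).2 hins
    rw [h.spans_iff I hI, hcl, not_subset] at hnot
    obtain ⟨f, hf, hfI⟩ := hnot
    have hfE : f ∈ M'.E := by rw [h.ground]; exact .inr (hF hf)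
    have hfI' : f ∉ I := fun hmem ↦ hfI (M'.mem_closure_of_mem hmem hI'.subset_ground)
    refine ⟨f, hf, hfI', ?_⟩
    rw [← indep_iff_of_deleteElem_eq h.delete_eq (hne f hf)]
    exact (hI'.notMem_closure_iff_of_notMem hfI' hfE).1 hfI
  · rintro ⟨f, hf, hfI, hins⟩
    rw [← indep_iff_of_deleteElem_eq h.delete_eq (hne f hf)] at hins
    have hI' := hins.subset (subset_insert f I)
    rw [← hI'.notMem_closure_iff_of_notMem heI (by simp [h.ground]), h.spans_iff I hI, hcl]
    exact fun hss ↦ (hI'.notMem_closure_iff_of_notMem hfI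
      (hins.subset_ground (mem_insert _ _))).2 hins (hss hf)

lemma IsColoopExtension.indep_iff (h : M.IsColoopExtension e M') :
    M'.Indep I ↔ M.Indep (I \ {e}) := by
  rw [← indep_iff_of_deleteElem_eq h.delete_eq (I := I \ {e}) (by simp)]
  refine ⟨fun hI ↦ hI.subset sdiff_subset, fun hI ↦ ?_⟩
  refine (h.coloop.insert_indep_of_indep hI).subset fun x hx ↦ ?_
  by_cases hxe : x = e
  exacts [.inl hxe, .inr ⟨hx, hxe⟩]

/-! ### Closure of gammoids under the operations -/

lemma IsGammoid.finite (h : M.IsGammoid) : M.Finite := by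
  obtain ⟨V, _, -, -, φ, -⟩ := h
  exact ⟨Finite.of_injective φ φ.injective⟩

lemma IsGammoid.mapSetEquiv {E : Set β} (h : M.IsGammoid) (e : M.E ≃ E) :
    (M.mapSetEquiv e).IsGammoid := by
  obtain ⟨V, hV, D, B, φ, h⟩ := h
  refine ⟨V, hV, D, B, (e.symm.toEmbedding.trans φ : E ↪ V), fun (I : Set E) ↦ ?_⟩
  have himg : ((e.symm.toEmbedding.trans φ : E ↪ V) : E → V) '' I = φ '' (e.symm '' I) := by
    rw [image_image]
    rfl
  have hI : (Subtype.val ⁻¹' (Subtype.val '' I) : Set E) = I :=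
    preimage_image_eq _ Subtype.val_injective
  refine Iff.trans ?_ (himg ▸ h (e.symm '' I))
  exact (mapSetEquiv_indep_iff M e).trans
    ((and_iff_left (Subtype.coe_image_subset E I)).trans
      (Iff.of_eq (congrArg (fun J ↦ M.Indep (Subtype.val '' (e.symm '' J))) hI)))

lemma IsPresented.delete (h : M.IsPresented) (D : Set α) : (M ＼ D).IsPresented := by
  obtain ⟨W, R, hW, hR, r, φ, hφ, h⟩ := h
  refine ⟨W, R, hW, hR, r, φ, hφ.mono sdiff_subset, fun I hI ↦ ?_⟩
  rw [delete_ground, subset_sdiff] at hI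
  rw [delete_indep_iff, and_iff_left hI.2, h I hI.1]

/-- Contracting `C` amounts to adjoining a basis `J` of `C` to the avoided set, that is, to removing
the points of `J` from every set. -/
lemma IsPresented.contract (h : M.IsPresented) (C : Set α) : (M ／ C).IsPresented := by
  obtain ⟨W, R, hW, hR, r, φ, hφ, h⟩ := h
  obtain ⟨J, hJ⟩ := M.exists_isBasis' C
  refine ⟨W, R, hW, hR, fun w u ↦ r w u ∧ u ∉ φ '' J, φ, hφ.mono sdiff_subset, fun I hI ↦ ?_⟩
  rw [contract_ground, subset_sdiff] at hI
  rw [hJ.contract_indep_iff, and_iff_left hI.2.symm, h _ (union_subset hI.1 hJ.indep.subset_ground),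
    image_union]
  simp only [HasSDRAvoiding, mem_union, not_or]
  grind

/-- The points of a presentation together with one new point, which represents `e`. -/
noncomputable def extendPoint {R : Type*} (φ : α → R) (e : α) (a : α) : Option R :=
  open Classical in if a = e then none else some (φ a)

@[simp] lemma extendPoint_self {R : Type*} (φ : α → R) (e : α) : extendPoint φ e e = none := by
  simp [extendPoint]

lemma extendPoint_of_ne {R : Type*} (φ : α → R) {a : α} (h : a ≠ e) :
    extendPoint φ e a = some (φ a) := by
  simp [extendPoint, h]

lemma injOn_extendPoint {R : Type*} {φ : α → R} {E : Set α} (hφ : InjOn φ E) :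
    InjOn (extendPoint φ e) (insert e E) := by
  intro a ha b hb hab
  by_cases hae : a = e <;> by_cases hbe : b = e
  · rw [hae, hbe]
  · simp [hae, extendPoint_of_ne φ hbe] at hab
  · simp [hbe, extendPoint_of_ne φ hae] at hab
  · rw [extendPoint_of_ne φ hae, extendPoint_of_ne φ hbe, Option.some_inj] at hab
    exact hφ (ha.resolve_left hae) (hb.resolve_left hbe) hab

lemma preimage_some_image_extendPoint {R : Type*} (φ : α → R) (e : α) (I : Set α) :
    some ⁻¹' (extendPoint φ e '' I) = φ '' (I \ {e}) := by
  ext v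
  constructor
  · rintro ⟨a, ha, h⟩
    by_cases hae : a = e
    · simp [hae] at h
    · rw [extendPoint_of_ne φ hae, Option.some_inj] at h
      exact ⟨a, ⟨ha, hae⟩, h⟩
  · rintro ⟨a, ⟨ha, hae⟩, rfl⟩
    exact ⟨a, ha, extendPoint_of_ne φ hae⟩

lemma none_mem_image_extendPoint_iff {R : Type*} {φ : α → R} :
    none ∈ extendPoint φ e '' I ↔ e ∈ I := by
  refine ⟨?_, fun h ↦ ⟨e, h, by simp⟩⟩
  rintro ⟨a, ha, h⟩
  by_contra he
  rw [extendPoint_of_ne φ (by rintro rfl; exact he ha)] at h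
  simp at h

lemma IsPresented.of_isColoopExtension (h : M.IsPresented) (h' : M.IsColoopExtension e M') :
    M'.IsPresented := by
  obtain ⟨W, R, hW, _, r, φ, hφ, h⟩ := h
  refine ⟨W, Option R, hW, inferInstance, fun w u ↦ ∃ v, u = some v ∧ r w v, extendPoint φ e,
    h'.ground ▸ injOn_extendPoint hφ, fun I hI ↦ ?_⟩
  rw [hasSDRAvoiding_map_iff (Option.some_injective R), preimage_some_image_extendPoint,
    h'.indep_iff, h]
  rw [sdiff_subset_iff]
  rwa [h'.ground] at hI

/-- The added set is `F ∪ {e}`. If `e ∉ I`, it is represented by `e` at no cost; if `e ∈ I`, it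
needs some `f ∈ F` outside `I`, and the other sets must then avoid `I - e + f`. -/
lemma IsPresented.of_isPrincipalExtension (h : M.IsPresented)
    (h' : M.IsPrincipalExtension F e M') : M'.IsPresented := by
  obtain ⟨W, R, _, _, r, φ, hφ, h⟩ := h
  refine ⟨Option W, Option R, inferInstance, inferInstance, fun o u ↦
    o.elim (u = none ∨ ∃ f ∈ F, u = some (φ f)) (fun w ↦ ∃ v, u = some v ∧ r w v),
    extendPoint φ e, h'.ground ▸ injOn_extendPoint hφ, fun I hI ↦ ?_⟩
  have hJ : I \ {e} ⊆ M.E := by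
    rw [sdiff_subset_iff]
    rwa [h'.ground] at hI
  simp only [hasSDRAvoiding_option_iff, Option.elim_none, Option.elim_some,
    hasSDRAvoiding_map_iff (Option.some_injective R)]
  by_cases heI : e ∈ I
  · have h'' := h'
    rw [← h'.flat.closure] at h''
    have hins : insert e (I \ {e}) = I := insert_sdiff_self_of_mem heI
    rw [← hins, h''.indep_insert_iff h'.flat.subset_ground hJ, hins]
    constructor
    · rintro ⟨f, hf, hfI, hind⟩
      refine ⟨some (φ f), .inr ⟨f, hf, rfl⟩, ?_, ?_⟩
      · rw [← mem_preimage, preimage_some_image_extendPoint,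
          hφ.mem_image_iff hJ (h'.flat.subset_ground hf)]
        exact hfI
      · rw [h _ hind.subset_ground, image_insert_eq] at hind
        convert hind using 1
        rw [← preimage_some_image_extendPoint]
        ext v
        simp
    · rintro ⟨u, rfl | ⟨f, hf, rfl⟩, hu, hsdr⟩
      · exact absurd (none_mem_image_extendPoint_iff.2 heI) hu
      · have hfE := h'.flat.subset_ground hf
        rw [← mem_preimage, preimage_some_image_extendPoint, hφ.mem_image_iff hJ hfE] at hu
        refine ⟨f, hf, hu, ?_⟩
        rw [h _ (insert_subset hfE hJ), image_insert_eq, ← preimage_some_image_extendPoint]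
        convert hsdr using 1
        ext v
        simp
  · rw [indep_iff_of_deleteElem_eq h'.delete_eq heI, ← sdiff_singleton_eq_self heI, h _ hJ,
      ← preimage_some_image_extendPoint, sdiff_singleton_eq_self heI]
    constructor
    · intro hsdr
      refine ⟨none, .inl rfl, fun hmem ↦ heI (none_mem_image_extendPoint_iff.1 hmem), ?_⟩
      convert hsdr using 1
      ext v
      simp
    · rintro ⟨u, -, -, hsdr⟩
      exact hsdr.mono (preimage_mono (subset_insert _ _))

/-! ### Gammoids are constructed -/

lemma isGammoid_U00 : U00.{u}.IsGammoid := by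
  refine ⟨PEmpty, inferInstance, ⟨fun _ _ ↦ False⟩, ∅, ⟨fun a ↦ a.1, Subtype.val_injective⟩,
    fun I ↦ iff_of_true ?_ ⟨fun x ↦ x.elim, fun x ↦ x.elim, fun x ↦ x.elim⟩⟩
  refine emptyOn_indep_iff.2 ?_
  exact eq_empty_of_isEmpty _

lemma constructed_freeOn {S : Set α} (hS : S.Finite) : Constructed U00.{u} (freeOn S) := by
  induction S, hS using Set.Finite.induction_on with
  | empty =>
    have : IsEmpty U00.{u}.E := ⟨fun x ↦ x.1.elim⟩
    have h := Constructed.relabel (N := U00.{u}) (Equiv.equivOfIsEmpty U00.{u}.E (∅ : Set α)) .base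
    rwa [ground_eq_empty_iff.1 (mapSetEquiv.ground _ _), ← freeOn_empty] at h
  | @insert e S he _ ih =>
    refine .addColoop (e := e) ⟨he, rfl, ?_, ?_⟩ ih
    · refine ext_indep (by simp [he]) fun I hI ↦ ?_
      have heI : e ∉ I := fun h ↦ (hI h).2 rfl
      simp [heI, subset_insert_iff_of_notMem]
    · simp [isColoop_iff_forall_mem_isBase]

lemma Constructed.of_image {γ : Type u} {N : Matroid γ} {L : Matroid β} {f : α → β}
    (hL : Constructed N L) (hf : InjOn f M.E) (hE : L.E = f '' M.E)
    (h : ∀ I ⊆ M.E, M.Indep I ↔ L.Indep (f '' I)) : Constructed N M := by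
  let e : L.E ≃ M.E := (Equiv.setCongr hE).trans (Equiv.Set.imageOfInjOn f M.E hf).symm
  have he : ∀ a : M.E, (e.symm a : β) = f a := fun a ↦ rfl
  convert hL.relabel e
  refine ext_indep rfl fun I hI ↦ ?_
  rw [h I hI, mapSetEquiv_indep_iff, and_iff_left hI]
  convert Iff.rfl using 2
  ext b
  simp only [mem_image, mem_preimage, Subtype.exists, exists_and_right, exists_eq_right]
  constructor
  · rintro ⟨hb, a, ha, haI, hab⟩
    exact ⟨a, haI, by rw [← he ⟨a, ha⟩, hab]⟩
  · rintro ⟨a, haI, rfl⟩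
    exact ⟨hE ▸ mem_image_of_mem f (hI haI), a, hI haI, haI, Subtype.ext (he _)⟩

/-- The transversal matroid on the points and the indices in `S`, in which each point is only
matched with itself, is constructed. -/
lemma exists_constructed_transversal {W R : Type u} [Finite W] [Finite R] (r : W → R → Prop)
    (g₀ : W → R) (S : Set W) : ∃ N : Matroid (R ⊕ W), Constructed U00.{u} N ∧ N.Finite ∧
      N.E = range Sum.inl ∪ Sum.inr '' S ∧ ∀ I ⊆ N.E, (N.Indep I ↔ ∃ g : W → R,
        InjOn g (Sum.inr ⁻¹' I) ∧ ∀ w, Sum.inr w ∈ I → r w (g w) ∧ Sum.inl (g w) ∉ I) := by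
  classical
  induction S, S.toFinite using Set.Finite.induction_on with
  | empty =>
    refine ⟨freeOn (range Sum.inl), constructed_freeOn (finite_range _), ⟨finite_range _⟩, by simp,
      fun I hI ↦ ?_⟩
    have hnot : ∀ w : W, (Sum.inr w : R ⊕ W) ∉ I := fun w hw ↦ by simpa using hI hw
    -- No index lies in `I`, so nothing is required of the function; `g₀` only guarantees that one
    -- exists, as `R` might be empty.
    refine iff_of_true (freeOn_indep hI) ⟨g₀, fun w hw ↦ absurd hw (hnot w),
      fun w hw ↦ absurd hw (hnot w)⟩
  | @insert w S hw _ ih =>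
    obtain ⟨N, hN, hfin, hE, h⟩ := ih
    have he : (Sum.inr w : R ⊕ W) ∉ N.E := by simp [hE, hw]
    have hFE : Sum.inl '' {u | r w u} ⊆ N.E := by
      rw [hE]
      exact (image_subset_range _ _).trans subset_union_left
    obtain ⟨N', hN'⟩ := exists_isPrincipalExtension
      (N.isFlat_closure (Sum.inl '' {u | r w u})) he
    refine ⟨N', .principal hN' hN, ⟨hN'.ground ▸ N.ground_finite.insert _⟩, ?_, fun I hI ↦ ?_⟩
    · rw [hN'.ground, hE, image_insert_eq, union_insert]
    rw [hN'.ground] at hI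
    by_cases heI : Sum.inr w ∈ I
    · have hJ : I \ {Sum.inr w} ⊆ N.E := by rwa [sdiff_subset_iff]
      have hins : insert (Sum.inr w) (I \ {Sum.inr w}) = I := insert_sdiff_self_of_mem heI
      rw [← hins, hN'.indep_insert_iff hFE hJ, hins]
      simp only [mem_image, mem_ofPred_eq, exists_exists_and_eq_and]
      constructor
      -- The exchanged point `u` becomes the representative of `w`. It differs from the other
      -- representatives because they avoid a set containing it.
      · rintro ⟨u, hu, huI, hind⟩
        obtain ⟨g, hg, hgr⟩ := (h _ hind.subset_ground).1 hind
        have hmem : ∀ {w'}, w' ≠ w → Sum.inr w' ∈ I →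
            Sum.inr w' ∈ insert (Sum.inl u) (I \ {Sum.inr w}) := by
          intro w' hne hw'
          exact .inr ⟨hw', by simpa using hne⟩
        have hgu : ∀ {w'}, w' ≠ w → Sum.inr w' ∈ I → g w' ≠ u ∧ Sum.inl (g w') ∉ I := by
          intro w' hne hw'
          have := (hgr w' (hmem hne hw')).2
          simpa [not_or] using this
        refine ⟨Function.update g w u, fun a ha b hb hab ↦ ?_, fun a ha ↦ ?_⟩
        · rcases eq_or_ne a w with rfl | hne <;> rcases eq_or_ne b a with rfl | hne'
          · rfl
          · rw [Function.update_self, Function.update_of_ne hne'] at hab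
            exact absurd hab.symm (hgu hne' hb).1
          · rfl
          · rcases eq_or_ne b w with rfl | hbw
            · rw [Function.update_self, Function.update_of_ne hne] at hab
              exact absurd hab (hgu hne ha).1
            · rw [Function.update_of_ne hne, Function.update_of_ne hbw] at hab
              exact hg (hmem hne ha) (hmem hbw hb) hab
        · rcases eq_or_ne a w with rfl | hne
          · rw [Function.update_self]
            exact ⟨hu, by simpa using huI⟩
          · rw [Function.update_of_ne hne]
            exact ⟨(hgr a (hmem hne ha)).1, (hgu hne ha).2⟩
      · rintro ⟨g, hg, hgr⟩
        refine ⟨g w, (hgr w heI).1, fun hmem ↦ (hgr w heI).2 hmem.1, ?_⟩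
        refine (h _ (insert_subset (hFE ⟨_, (hgr w heI).1, rfl⟩) hJ)).2 ⟨g, ?_, ?_⟩
        · exact hg.mono fun a ha ↦ by simpa using (show Sum.inr a ∈ I from by simp at ha; exact ha.1)
        · intro a ha
          simp only [mem_insert_iff, reduceCtorEq, mem_sdiff, mem_singleton_iff, Sum.inr.injEq,
            false_or] at ha
          refine ⟨(hgr a ha.1).1, ?_⟩
          rintro (heq | hmem)
          · exact ha.2 (hg ha.1 heI (Sum.inl_injective heq))
          · exact (hgr a ha.1).2 hmem.1
    · rw [indep_iff_of_deleteElem_eq hN'.delete_eq heI]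
      exact h I ((subset_insert_iff_of_notMem heI).1 hI)

lemma IsPresented.constructed (h : M.IsPresented) : Constructed U00.{u} M := by
  obtain ⟨W, R, _, _, r, φ, hφ, h⟩ := h
  obtain ⟨g₀, hg₀, hr₀⟩ := (h ∅ (empty_subset _)).1 M.empty_indep
  obtain ⟨N, hN, -, hE, hNI⟩ := exists_constructed_transversal r g₀ univ
  rw [image_univ, range_inl_union_range_inr] at hE
  -- With every index present, all sets must be matched outside `X`. Contracting the indices
  -- therefore leaves the presented matroid on `R`.
  have hmatch : ∀ X : Set R, N.Indep (Sum.inl '' X ∪ range Sum.inr) ↔ HasSDRAvoiding r X := by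
    intro X
    rw [hNI _ (hE ▸ subset_univ _), HasSDRAvoiding]
    have : Sum.inr ⁻¹' (Sum.inl '' X ∪ range Sum.inr : Set (R ⊕ W)) = univ := by
      ext w; simp
    simp [this, injOn_univ]
  have hind : N.Indep (range Sum.inr) := by
    simpa using (hmatch ∅).2 ⟨g₀, hg₀, fun w ↦ ⟨(hr₀ w).1, by simp⟩⟩
  refine Constructed.of_image (f := Sum.inl ∘ φ)
    ((hN.contract (range Sum.inr)).delete (Sum.inl '' (φ '' M.E))ᶜ)
    (Sum.inl_injective.comp_injOn hφ) ?_ fun I hI ↦ ?_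
  · rw [delete_ground, contract_ground, hE, image_comp]
    ext (x | x) <;> simp
  · rw [delete_indep_iff, hind.contract_indep_iff, image_comp, hmatch, h I hI,
      disjoint_compl_right_iff_subset]
    have h1 : Disjoint (Sum.inl '' (φ '' I)) (range (Sum.inr : W → R ⊕ W)) := by
      rw [disjoint_left]; rintro _ ⟨a, -, rfl⟩; simp
    have h2 : (Sum.inl '' (φ '' I) : Set (R ⊕ W)) ⊆ Sum.inl '' (φ '' M.E) :=
      image_mono (image_mono hI)
    tauto

/-! ### The least closed class -/

lemma isClosedClass_isGammoid : IsClosedClass.{u} fun _ M ↦ M.IsGammoid where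
  finite h := h.finite
  nonempty := ⟨_, _, isGammoid_U00⟩
  iso e h := h.mapSetEquiv e
  minor := by
    rintro α M N ⟨C, D, rfl⟩ h
    exact ((h.isPresented.contract C).delete D).isGammoid
  addColoop h' h := (h.isPresented.of_isColoopExtension h').isGammoid
  principal h' h := (h.isPresented.of_isPrincipalExtension h').isGammoid

/-- Every class that is closed under the operations contains all `U_{0,0}`-constructed matroids. -/
lemma IsClosedClass.of_constructed {𝓒 : MatroidClass.{u}} (h𝓒 : IsClosedClass 𝓒)
    (h : Constructed U00.{u} M) : 𝓒 α M := by
  induction h with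
  | base =>
    obtain ⟨β, L, hL⟩ := h𝓒.nonempty
    -- Deleting everything from any member gives an empty matroid, which is relabelled as `U00`.
    have hmin : L ＼ L.E ≤m L := ⟨∅, L.E, by simp⟩
    have hempty : (L ＼ L.E).E = ∅ := by simp
    have : IsEmpty (L ＼ L.E).E := by rw [hempty]; infer_instance
    have h := h𝓒.iso (Equiv.equivOfIsEmpty (L ＼ L.E).E (∅ : Set PEmpty.{u + 1}))
      (h𝓒.minor hmin hL)
    rwa [eq_emptyOn (mapSetEquiv _ _)] at h
  | relabel e _ ih => exact h𝓒.iso e ih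
  | delete D _ ih => exact h𝓒.minor ⟨∅, D, by simp⟩ ih
  | contract C _ ih => exact h𝓒.minor ⟨C, ∅, by simp⟩ ih
  | addColoop h _ ih => exact h𝓒.addColoop h ih
  | principal h _ ih => exact h𝓒.principal h ih

end Matroid

theorem theorem3p3 :
    (∀ (α : Type u) (M : Matroid α), M.IsGammoid ↔ Matroid.Constructed Matroid.U00.{u} M) ∧
    IsLeast {𝓒 : Matroid.MatroidClass.{u} | Matroid.IsClosedClass 𝓒}
      (fun _ M => M.IsGammoid) :=
  ⟨fun _ _ ↦ ⟨fun h ↦ h.isPresented.constructed,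
    fun h ↦ Matroid.isClosedClass_isGammoid.of_constructed h⟩,
    Matroid.isClosedClass_isGammoid, fun _ h𝓒 _ _ h ↦ h𝓒.of_constructed h.isPresented.constructed⟩
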